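/- Throughout, $\Gamma$ is a finite abelian group, written additively. A graph $G=(V,E)$ with $|E|=|\Gamma|$ is called *$\Gamma$-harmonious* if there is an injection $f:V\to\Gamma$ (a *$\Gamma$-harmonious labeling*) such that the induced edge labels $w(xy)=f(x)+f(y)$, $xy\in E$, are pairwise distinct; equivalently, $w:E\to\Gamma$ is a bijection. The *generalized prism* $Y_{m,n}=P_m\,\Box\,C_n$ is the Cartesian product of the path $P_m$ on $m$ vertices and the cycle $C_n$ on $n$ vertices. The *generalized closed web* $CW_{m,n}$ arises from $Y_{m,n}$ by adding one new vertex and joining it by an edge to every vertex of the top cycle, i.e. of the copy of $C_n$ at one end vertex of $P_m$; it has $2mn$ edges. **Theorem.** Let $n\ge 3$ and $m\ge 2$ be integers and let $\Gamma$ be an abelian group of order $2mn$. Suppose that $\Gamma$ has a subgroup $H$ of order $n$ such that the quotient group $\Gamma/H$ is cyclic and such that either 1. $n$ is odd, or 2. $n$ is even and $H$ has a subgroup isomorphic to $\mathbb{Z}_2\oplus\mathbb{Z}_{2s}$ for some integer $s\ge 2$. Then the generalized closed web $CW_{m,n}$ is $\Gamma$-harmonious, that is, it admits a $\Gamma$-harmonious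 labeling. -/

import Mathlib

/-- The label `f x + f y` that a vertex labeling `f` induces on the unordered pair `s(x, y)`. -/
def edgeLabel {V Γ : Type*} [AddCommGroup Γ] (f : V → Γ) : Sym2 V → Γ :=
  Sym2.lift ⟨fun x y => f x + f y, fun x y => add_comm (f x) (f y)⟩

/-- `f` is a `Γ`-harmonious labeling of `G`: it is injective on the vertices, and the induced
labels `f x + f y` of the edges are pairwise distinct and exhaust `Γ` (so that, in particular,
the number of edges of `G` is the order of `Γ`). -/
def IsHarmoniousLabeling {V Γ : Type*} [AddCommGroup Γ] (G : SimpleGraph V) (f : V → Γ) : Prop :=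
  Function.Injective f ∧ Set.BijOn (edgeLabel f) G.edgeSet Set.univ

/-- The graph `G` is `Γ`-harmonious. -/
def IsHarmonious {V : Type*} (Γ : Type*) [AddCommGroup Γ] (G : SimpleGraph V) : Prop :=
  ∃ f : V → Γ, IsHarmoniousLabeling G f

/-- The generalized prism `Y_{m,n}`: the Cartesian product of the path `P_m` on `m` vertices and
the cycle `C_n`. The vertices `(j, i)` with `j` fixed form the `j`-th copy of `C_n`. -/
def generalizedPrism (m n : ℕ) : SimpleGraph (Fin m × Fin n) :=
  (SimpleGraph.pathGraph m).boxProd (SimpleGraph.cycleGraph n)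

/-- The generalized closed web `CW_{m,n}`: the generalized prism `Y_{m,n}` (vertices `some (j, i)`)
together with a new vertex `none`, joined to every vertex `some (0, i)` of the top cycle. -/
def generalizedClosedWeb (m n : ℕ) : SimpleGraph (Option (Fin m × Fin n)) where
  Adj
    | none, none => False
    | none, some y => y.1.val = 0
    | some x, none => x.1.val = 0
    | some x, some y => (generalizedPrism m n).Adj x y
  symm := ⟨by
    rintro (_ | x) (_ | y) h
    · exact h
    · exact h
    · exact h
    · exact SimpleGraph.Adj.symm h⟩
  loopless := ⟨by
    rintro (_ | x) h
    · exact h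
    · exact (generalizedPrism m n).irrefl h⟩

/-- The group `A` has order `n`, and either `n` is odd, or `n` is even and `A` has a subgroup
isomorphic to `Z_2 ⊕ Z_{2s}` for some `s ≥ 2`. -/
def SatisfiesCycleCondition (n : ℕ) (A : Type*) [AddCommGroup A] : Prop :=
  Nat.card A = n ∧
    (Odd n ∨
      (Even n ∧ ∃ s : ℕ, 2 ≤ s ∧ ∃ K : AddSubgroup A, Nonempty (K ≃+ ZMod 2 × ZMod (2 * s))))

/-! Choose `g` in `Γ` generating `Γ ⧸ H`, which is cyclic of order `2 * m`, and a cyclic listing `a`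
of `H` whose consecutive sums are distinct. Label position `i` of cycle `j` by `j • g + a (i + j)`
and the apex by `(2 * m - 1) • g`. Cycle `j` then has its edge labels in the coset of `(2 * j) • g`,
the rungs between cycles `j` and `j + 1` in that of `(2 * j + 1) • g`, and the apex edges in the one
remaining coset. Because of the shift by `j`, the `H`-parts are consecutive sums of `a` on cycles
and rungs, and entries of `a` at the apex, so every coset is filled exactly once.

It remains to find `a`. Listings lift along a surjection with kernel of odd order
(`IsCyclicallyHarmonious.of_odd_ker`), which settles odd order by induction. They also lift along a
surjection onto a group of order at least 3 whose kernel is elementary abelian of order 4 or 8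
(`IsCyclicallyHarmonious.of_exponent_two_ker`). In the even case, decompose `H` into cyclic groups
of prime power order and use these two lifts to reduce to odd order, to `ZMod 2 × ZMod (4 * h)`, or
to one of two groups of order 16 (`isCyclicallyHarmonious_of_two_involutions`). -/

/-- The elements of the finite abelian group `A` can be listed cyclically, `a 0, a 1, …`, so that
the sums of consecutive elements are pairwise distinct. -/
def IsCyclicallyHarmonious (A : Type*) [AddCommGroup A] : Prop :=
  ∃ a : ℕ → A, (∀ k, a (k + Nat.card A) = a k) ∧
    (∀ k < Nat.card A, ∀ l < Nat.card A, a k = a l → k = l) ∧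
    ∀ k < Nat.card A, ∀ l < Nat.card A, a k + a (k + 1) = a l + a (l + 1) → k = l

/-! ### Assembling cyclic listings -/

theorem isCyclicallyHarmonious_of_wrap {A : Type*} [AddCommGroup A] {N : ℕ} (hN : 0 < N)
    (hA : Nat.card A = N) (a : ℕ → A) (hwrap : a N = a 0)
    (ha : ∀ k < N, ∀ l < N, a k = a l → k = l)
    (hs : ∀ k < N, ∀ l < N, a k + a (k + 1) = a l + a (l + 1) → k = l) :
    IsCyclicallyHarmonious A := by
  have key : ∀ k < N, a ((k + 1) % N) = a (k + 1) := by
    intro k hk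
    rcases (Nat.succ_le_of_lt hk).lt_or_eq with h | h
    · rw [Nat.mod_eq_of_lt h]
    · have h' : k + 1 = N := h
      rw [h', Nat.mod_self, hwrap]
  subst hA
  refine ⟨fun k => a (k % Nat.card A), fun k => by simp, ?_, ?_⟩
  · intro k hk l hl h
    simp only [Nat.mod_eq_of_lt hk, Nat.mod_eq_of_lt hl] at h
    exact ha k hk l hl h
  · intro k hk l hl h
    simp only [Nat.mod_eq_of_lt hk, Nat.mod_eq_of_lt hl, key k hk, key l hl] at h
    exact hs k hk l hl h

/-- The listing is read row by row. Each row carries an extra entry in column `n`, which is the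
first entry of the next row, so sums across a row break need no separate treatment. -/
theorem isCyclicallyHarmonious_of_grid {A : Type*} [AddCommGroup A] {N n : ℕ} (hN : 0 < N)
    (hn : 0 < n) (hA : Nat.card A = N * n) (F : ℕ → ℕ → A)
    (hstep : ∀ j < N, F j n = F (j + 1) 0) (hwrap : F N 0 = F 0 0)
    (hF : ∀ j < N, ∀ i < n, ∀ j' < N, ∀ i' < n, F j i = F j' i' → j = j' ∧ i = i')
    (hs : ∀ j < N, ∀ i < n, ∀ j' < N, ∀ i' < n,
      F j i + F j (i + 1) = F j' i' + F j' (i' + 1) → j = j' ∧ i = i') :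
    IsCyclicallyHarmonious A := by
  have hdiv : ∀ k < N * n, k / n < N := fun k hk => by
    rw [Nat.div_lt_iff_lt_mul hn]; exact hk
  have key : ∀ k < N * n, F ((k + 1) / n) ((k + 1) % n) = F (k / n) (k % n + 1) := by
    intro k hk
    have hm := Nat.mod_lt k hn
    have hk' := Nat.div_add_mod k n
    rcases (Nat.succ_le_of_lt hm).lt_or_eq with h | h
    · have h1 : (k + 1) / n = k / n := by
        rw [Nat.div_eq_iff hn]
        constructor
        · rw [mul_comm]; omega
        · rw [mul_comm]; omega
      have h2 := Nat.div_add_mod (k + 1) n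
      rw [h1] at h2
      rw [h1]
      congr 1
      omega
    · have h' : k % n + 1 = n := h
      have h1 : k + 1 = n * (k / n + 1) := by rw [Nat.mul_add]; omega
      rw [h', hstep _ (hdiv k hk), h1, Nat.mul_div_cancel_left _ hn, Nat.mul_mod_right]
  refine isCyclicallyHarmonious_of_wrap (Nat.mul_pos hN hn) hA
    (fun k => F (k / n) (k % n)) ?_ ?_ ?_
  · simp [Nat.mul_div_cancel _ hn, hwrap]
  · intro k hk l hl h
    obtain ⟨h1, h2⟩ := hF _ (hdiv k hk) _ (Nat.mod_lt k hn) _ (hdiv l hl) _ (Nat.mod_lt l hn) h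
    rw [← Nat.div_add_mod k n, ← Nat.div_add_mod l n, h1, h2]
  · intro k hk l hl h
    simp only [key k hk, key l hl] at h
    obtain ⟨h1, h2⟩ := hs _ (hdiv k hk) _ (Nat.mod_lt k hn) _ (hdiv l hl) _ (Nat.mod_lt l hn) h
    rw [← Nat.div_add_mod k n, ← Nat.div_add_mod l n, h1, h2]

/-! ### Kernels of odd order and groups of odd order -/

theorem card_eq_card_ker_mul_card {A B : Type*} [AddCommGroup A] [AddCommGroup B] (π : A →+ B)
    (hπ : Function.Surjective π) : Nat.card A = Nat.card π.ker * Nat.card B := by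
  rw [π.ker.card_eq_card_quotient_mul_card_addSubgroup, mul_comm,
    Nat.card_congr (QuotientAddGroup.quotientKerEquivOfSurjective π hπ).toEquiv]

theorem two_nsmul_injective_of_odd_card {A : Type*} [AddCommGroup A] (hA : Odd (Nat.card A))
    {x y : A} (h : x + x = y + y) : x = y := by
  have h1 : 2 • (x - y) = 0 := by rw [two_nsmul, sub_add_sub_comm, h, sub_self]
  have h2 : Nat.card A • (x - y) = 0 := card_nsmul_eq_zero'
  have h3 : addOrderOf (x - y) ∣ 1 := by
    have := Nat.dvd_gcd (addOrderOf_dvd_of_nsmul_eq_zero h1) (addOrderOf_dvd_of_nsmul_eq_zero h2)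
    rwa [Nat.Coprime.gcd_eq_one (Nat.coprime_two_left.mpr hA)] at this
  have h4 := AddMonoid.addOrderOf_eq_one_iff.mp (Nat.dvd_one.mp h3)
  exact sub_eq_zero.mp h4

/-- Lifting a cyclic harmonious listing along a surjection with kernel of odd order. -/
theorem IsCyclicallyHarmonious.of_odd_ker {A B : Type*} [AddCommGroup A] [AddCommGroup B]
    [Finite A] (π : A →+ B) (hπ : Function.Surjective π) (hodd : Odd (Nat.card π.ker))
    (hker : IsCyclicallyHarmonious π.ker) (hB : IsCyclicallyHarmonious B) :
    IsCyclicallyHarmonious A := by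
  obtain ⟨b, hbp, hb, hbs⟩ := hker
  obtain ⟨a, hap, ha, has⟩ := hB
  have : Finite B := Finite.of_surjective π hπ
  set n := Nat.card B with hn
  set N := Nat.card π.ker with hN
  have hn0 : 0 < n := Nat.card_pos
  set ℓ : B → A := Function.surjInv hπ with hℓ
  have hℓπ : ∀ x, π (ℓ x) = x := Function.surjInv_eq hπ
  have hbπ : ∀ r, π (b r) = 0 := fun r => (b r).2
  have han : a n = a 0 := by simpa using hap 0
  refine isCyclicallyHarmonious_of_grid (N := N) (n := n) Nat.card_pos hn0
    (card_eq_card_ker_mul_card π hπ)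
    -- Lap `r` runs once through lifts of the listing of `B`, translated by the kernel element `b
    -- r`; the last column already belongs to lap `r + 1`.
    (fun r i => ℓ (a i) + if i = n then (b (r + 1) : A) else b r) ?_ ?_ ?_ ?_
  · intro j _
    simp [han, hn0.ne]
  · have : b N = b 0 := by simpa using hbp 0
    simp [hn0.ne, this]
  · intro j hj i hi j' hj' i' hi' h
    simp only [hi.ne, hi'.ne, if_false] at h
    have h1 := congrArg π h
    simp only [map_add, hℓπ, hbπ, add_zero] at h1
    have h2 := ha i hi i' hi' h1
    subst h2
    exact ⟨hb j hj j' hj' (Subtype.ext (add_left_cancel h)), rfl⟩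
  · intro j hj i hi j' hj' i' hi' h
    have hite : ∀ r k, π (if k = n then (b (r + 1) : A) else b r) = 0 := by
      intro r k; split_ifs <;> exact hbπ _
    have h1 := congrArg π h
    simp only [map_add, hℓπ, hite, add_zero] at h1
    have h2 := has i hi i' hi' h1
    subst h2
    refine ⟨?_, rfl⟩
    simp only [hi.ne, if_false] at h
    rw [add_add_add_comm, add_add_add_comm (ℓ (a i)) (b j' : A)] at h
    have h3 := add_left_cancel h
    -- At the end of a lap the kernel parts add up to `b r + b (r + 1)`, a consecutive sum;
    -- elsewhere they add up to `b r + b r`, and doubling is injective in odd order.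
    split_ifs at h3 with hin
    · exact hbs j hj j' hj' (Subtype.ext (by simpa using h3))
    · exact hb j hj j' hj' (two_nsmul_injective_of_odd_card hodd (Subtype.ext (by simpa using h3)))

theorem isCyclicallyHarmonious_zmultiples {A : Type*} [AddCommGroup A] [Finite A] (x : A)
    (hx : Odd (addOrderOf x)) : IsCyclicallyHarmonious (AddSubgroup.zmultiples x) := by
  set y : AddSubgroup.zmultiples x := ⟨x, AddSubgroup.mem_zmultiples x⟩ with hy
  have hyo : addOrderOf y = addOrderOf x := AddSubgroup.addOrderOf_mk _ _
  have hcard : Nat.card (AddSubgroup.zmultiples x) = addOrderOf x := Nat.card_zmultiples x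
  have hinj : ∀ k < addOrderOf x, ∀ l < addOrderOf x, k • y = l • y → k = l := by
    intro k hk l hl h
    rw [← hyo] at hk hl
    exact nsmul_injOn_Iio_addOrderOf hk hl h
  refine isCyclicallyHarmonious_of_wrap (addOrderOf_pos x) hcard (fun k => k • y) ?_ hinj ?_
  · simp [← hyo, addOrderOf_nsmul_eq_zero]
  · intro k hk l hl h
    simp only [succ_nsmul, ← add_assoc] at h
    exact hinj k hk l hl (two_nsmul_injective_of_odd_card (hcard ▸ hx) (add_right_cancel h))

theorem isCyclicallyHarmonious_of_subsingleton {A : Type*} [AddCommGroup A] [Subsingleton A] :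
    IsCyclicallyHarmonious A :=
  isCyclicallyHarmonious_of_wrap one_pos (Nat.card_unique (α := A)) (fun _ => 0) rfl
    (fun _ _ _ _ _ => by omega) (fun _ _ _ _ _ => by omega)

/-- Induction on the order: a nonzero element spans a cyclic subgroup of odd order, whose multiples
in their natural order form a listing, and the quotient is smaller. -/
theorem isCyclicallyHarmonious_of_odd_card {A : Type*} [AddCommGroup A]
    (hA : Odd (Nat.card A)) : IsCyclicallyHarmonious A := by
  induction hc : Nat.card A using Nat.strong_induction_on generalizing A with
  | _ c ih =>
    have : Finite A := Nat.finite_of_card_ne_zero (by rintro h; simp [h] at hA)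
    rcases subsingleton_or_nontrivial A with _ | _
    · exact isCyclicallyHarmonious_of_subsingleton
    · obtain ⟨x, hx⟩ := exists_ne (0 : A)
      set L := AddSubgroup.zmultiples x with hL
      have hxodd : Odd (addOrderOf x) := hA.of_dvd_nat (addOrderOf_dvd_natCard x)
      have hker : (QuotientAddGroup.mk' L).ker = L := QuotientAddGroup.ker_mk' L
      have hsurj : Function.Surjective (QuotientAddGroup.mk' L) := QuotientAddGroup.mk'_surjective L
      have hcard := L.card_eq_card_quotient_mul_card_addSubgroup
      have hLc : Nat.card L = addOrderOf x := Nat.card_zmultiples x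
      refine IsCyclicallyHarmonious.of_odd_ker (QuotientAddGroup.mk' L) hsurj ?_ ?_ ?_
      · rw [hker, hLc]; exact hxodd
      · rw [hker]; exact isCyclicallyHarmonious_zmultiples x hxodd
      · refine ih _ ?_ (hA.of_dvd_nat (Dvd.intro _ hcard.symm)) rfl
        have h1 : addOrderOf x ≠ 1 := fun h => hx (AddMonoid.addOrderOf_eq_one_iff.mp h)
        have h2 := addOrderOf_pos x
        have h3 : 0 < Nat.card (A ⧸ L) := Nat.card_pos
        rw [← hc, hcard, hLc]
        nlinarith [show 2 ≤ addOrderOf x by omega]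

theorem IsCyclicallyHarmonious.of_odd_card_ker {A B : Type*} [AddCommGroup A] [AddCommGroup B]
    [Finite A] (π : A →+ B) (hπ : Function.Surjective π) (hodd : Odd (Nat.card π.ker))
    (hB : IsCyclicallyHarmonious B) : IsCyclicallyHarmonious A :=
  IsCyclicallyHarmonious.of_odd_ker π hπ hodd (isCyclicallyHarmonious_of_odd_card hodd) hB

theorem IsCyclicallyHarmonious.of_addEquiv {A B : Type*} [AddCommGroup A] [AddCommGroup B]
    (e : A ≃+ B) (hB : IsCyclicallyHarmonious B) : IsCyclicallyHarmonious A := by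
  obtain ⟨a, h1, h2, h3⟩ := hB
  rw [← Nat.card_congr e.toEquiv] at h1 h2 h3
  refine ⟨fun k => e.symm (a k), fun k => by simp only [h1], ?_, ?_⟩
  · intro k hk l hl h
    exact h2 k hk l hl (e.symm.injective h)
  · intro k hk l hl h
    simp only [← map_add] at h
    exact h3 k hk l hl (e.symm.injective h)

/-! ### Strand systems: kernels of order 4 and 8 -/

/-- Sequences in a group `T` that let `N` parallel strands through the fibres of a surjection with
kernel `T` be closed up to a single cycle: `u`, `v`, `w` list `T` with pairwise sums listing `T`,
and `p`, `q` are the turning points at the two ends of the strands. -/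
structure IsStrandSystem {T : Type*} [AddCommGroup T] (N : ℕ) (p u v w q : ℕ → T) : Prop where
  even : Even N
  p_wrap : p N = p 0
  p_step : ∀ j < N, ¬ Even j → p j = p (j + 1)
  q_step : ∀ j < N, Even j → q j = q (j + 1)
  turn_inj : ∀ j < N, ∀ k < N, (if Even j then p j else q j) = (if Even k then p k else q k) → j = k
  u_inj : ∀ j < N, ∀ k < N, u j = u k → j = k
  v_inj : ∀ j < N, ∀ k < N, v j = v k → j = k
  w_inj : ∀ j < N, ∀ k < N, w j = w k → j = k
  pu_inj : ∀ j < N, ∀ k < N, p j + u j = p k + u k → j = k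
  uv_inj : ∀ j < N, ∀ k < N, u j + v j = u k + v k → j = k
  uw_inj : ∀ j < N, ∀ k < N, u j + w j = u k + w k → j = k
  vw_inj : ∀ j < N, ∀ k < N, v j + w j = v k + w k → j = k
  vq_inj : ∀ j < N, ∀ k < N, v j + q j = v k + q k → j = k

/-- The positions of the strands in the `i`-th fibre, where the `0`-th and the `n`-th fibre are
the same one, in which the strands turn. -/
def strandLevel {T : Type*} (n : ℕ) (p u v w q : ℕ → T) (i : ℕ) : ℕ → T :=
  if i = 0 then p else if i = n then q else if i = 1 then u else
    if Even (n - 1 - i) then v else w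

theorem IsStrandSystem.strandLevel_inj {T : Type*} [AddCommGroup T] {N n : ℕ} {p u v w q : ℕ → T}
    (h : IsStrandSystem N p u v w q) {i : ℕ} (hi : 0 < i) (hin : i < n) :
    ∀ j < N, ∀ k < N, strandLevel n p u v w q i j = strandLevel n p u v w q i k → j = k := by
  unfold strandLevel
  rw [if_neg hi.ne', if_neg hin.ne]
  split_ifs
  · exact h.u_inj
  · exact h.v_inj
  · exact h.w_inj

/-- The alternation of `v` and `w` is counted back from `n`, so that `v` always meets `q`. Hence `u`
is followed by `v` or by `w` according to the parity of `n`, and both pairs must have distinct sums.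
The bound `3 ≤ n` keeps positions `1` and `n - 1` apart. -/
theorem IsStrandSystem.strandLevel_add_inj {T : Type*} [AddCommGroup T] {N n : ℕ}
    {p u v w q : ℕ → T} (h : IsStrandSystem N p u v w q) (hn : 3 ≤ n) {i : ℕ} (hin : i < n) :
    ∀ j < N, ∀ k < N,
      strandLevel n p u v w q i j + strandLevel n p u v w q (i + 1) j =
        strandLevel n p u v w q i k + strandLevel n p u v w q (i + 1) k → j = k := by
  unfold strandLevel
  rcases Nat.eq_zero_or_pos i with rfl | hi
  · simp only [if_true, zero_add, one_ne_zero, if_false, show (1 : ℕ) ≠ n by omega]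
    exact h.pu_inj
  rw [if_neg hi.ne', if_neg hin.ne, if_neg (Nat.succ_ne_zero i), if_neg (by omega : ¬ i + 1 = 1)]
  by_cases hin' : i + 1 = n
  · rw [if_pos hin', if_neg (by omega : ¬ i = 1), if_pos (by rw [Nat.even_iff]; omega)]
    exact h.vq_inj
  rw [if_neg hin']
  by_cases hi1 : i = 1
  · rw [if_pos hi1]
    split_ifs
    · exact h.uv_inj
    · exact h.uw_inj
  · rw [if_neg hi1]
    by_cases he : Even (n - 1 - i)
    · rw [if_pos he, if_neg (by rw [Nat.even_iff] at he ⊢; omega)]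
      exact h.vw_inj
    · rw [if_neg he, if_pos (by rw [Nat.even_iff] at he ⊢; omega)]
      intro j hj k hk hjk
      exact h.vw_inj j hj k hk (by rw [add_comm, hjk, add_comm])

/-- Lifting a cyclic harmonious listing along a surjection whose kernel has a strand system. -/
theorem IsCyclicallyHarmonious.of_isStrandSystem {A B T : Type*} [AddCommGroup A] [AddCommGroup B]
    [AddCommGroup T] [Finite A] (π : A →+ B) (hπ : Function.Surjective π) (ι : T →+ A)
    (hι : Function.Injective ι) (hιπ : ∀ t, π (ι t) = 0) {N : ℕ} (hN : Nat.card π.ker = N)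
    {p u v w q : ℕ → T} (h : IsStrandSystem N p u v w q) (hB3 : 3 ≤ Nat.card B)
    (hB : IsCyclicallyHarmonious B) : IsCyclicallyHarmonious A := by
  obtain ⟨a, hap, ha, has⟩ := hB
  set n := Nat.card B with hn
  have hn0 : 0 < n := by omega
  have hN0 : 0 < N := hN ▸ Nat.card_pos
  set ℓ : B → A := Function.surjInv hπ with hℓ
  have hℓπ : ∀ x, π (ℓ x) = x := Function.surjInv_eq hπ
  have han : a n = a 0 := by simpa using hap 0
  set c : ℕ → ℕ → A := fun i j => ℓ (a i) + ι (strandLevel n p u v w q i j) with hc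
  have hcπ : ∀ i j, π (c i j) = a i := fun i j => by simp [hc, hℓπ, hιπ]
  have hc0 : ∀ j, c 0 j = ℓ (a 0) + ι (p j) := fun j => by simp [hc, strandLevel]
  have hcn : ∀ j, c n j = ℓ (a 0) + ι (q j) := fun j => by
    simp [hc, strandLevel, han, hn0.ne']
  have hcinj : ∀ i, 0 < i → i < n → ∀ j < N, ∀ k < N, c i j = c i k → j = k := by
    intro i hi hin j hj k hk hjk
    exact h.strandLevel_inj hi hin j hj k hk (hι (add_left_cancel hjk))
  have hcadd : ∀ i < n, ∀ j < N, ∀ k < N, c i j + c (i + 1) j = c i k + c (i + 1) k → j = k := by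
    intro i hin j hj k hk hjk
    refine h.strandLevel_add_inj hB3 hin j hj k hk (hι ?_)
    simp only [hc] at hjk
    rw [add_add_add_comm, add_add_add_comm (ℓ (a i)) (ι (strandLevel n p u v w q i k))] at hjk
    simpa using hjk
  refine isCyclicallyHarmonious_of_grid (N := N) (n := n) hN0 hn0
    (hN ▸ card_eq_card_ker_mul_card π hπ)
    -- Even strands run forwards from fibre `0` to fibre `n`, odd ones backwards. Both ends lie over
    -- `a 0`, where each strand starts at the point at which its predecessor stopped.
    (fun j i => if Even j then c i j else c (n - i) j) ?_ ?_ ?_ ?_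
  · intro j hj
    by_cases he : Even j
    · simp [he, Nat.even_add_one, hcn, h.q_step j hj he]
    · simp [he, Nat.even_add_one, hc0, h.p_step j hj he]
  · simp only [if_pos h.even, Even.zero, if_true, hc0, h.p_wrap]
  · intro j hj i hi j' hj' i' hi' hji
    -- Here `e` is the fibre visited. The fibre over `a 0` is treated apart, since there an entry is
    -- a value of `p` or `q` depending on the direction of the strand.
    have hfib : ∀ j i, i < n → ∃ e < n, π (if Even j then c i j else c (n - i) j) = a e ∧
        (if i = 0 then e = 0 else 0 < e ∧ (if Even j then c i j else c (n - i) j) = c e j) ∧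
        (if Even j then e = i else e = (n - i) % n) := by
      intro j i hi
      by_cases h0 : i = 0
      · subst h0
        refine ⟨0, hn0, ?_, rfl, by simp⟩
        split_ifs
        · exact hcπ _ _
        · rw [hcπ, Nat.sub_zero, han]
      · simp only [if_neg h0]
        split_ifs with he
        · exact ⟨i, hi, hcπ _ _, ⟨by omega, rfl⟩, rfl⟩
        · exact ⟨n - i, by omega, hcπ _ _, ⟨by omega, rfl⟩, by rw [Nat.mod_eq_of_lt (by omega)]⟩
    obtain ⟨e, he, he1, he2, he3⟩ := hfib j i hi
    obtain ⟨e', he', he1', he2', he3'⟩ := hfib j' i' hi'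
    have hee : e = e' := ha e he e' he' (by rw [← he1, ← he1', hji])
    subst hee
    by_cases h0 : i = 0
    · have h0' : i' = 0 := by
        by_contra h0'
        rw [if_pos h0] at he2
        rw [if_neg h0'] at he2'
        omega
      subst h0 h0'
      refine ⟨h.turn_inj j hj j' hj' ?_, rfl⟩
      simp only [Nat.sub_zero, hc0, hcn] at hji
      split_ifs at hji ⊢ <;> exact hι (add_left_cancel hji)
    · have h0' : i' ≠ 0 := by
        intro h0'
        rw [if_neg h0] at he2
        rw [if_pos h0'] at he2'
        omega
      rw [if_neg h0] at he2
      rw [if_neg h0'] at he2'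
      have hjj : j = j' := hcinj e he2.1 he j hj j' hj' (by rw [← he2.2, ← he2'.2, hji])
      subst hjj
      refine ⟨rfl, ?_⟩
      split_ifs at he3 he3' with hej
      · omega
      · rw [Nat.mod_eq_of_lt (by omega)] at he3 he3'
        omega
  · intro j hj i hi j' hj' i' hi' hji
    -- Run backwards, step `i` of a strand joins fibres `n - i` and `n - 1 - i`; the sum ignores the
    -- direction, so the step is indexed by the lower fibre.
    have hfib : ∀ j i, i < n → ∃ e < n, (if Even j then e = i else e = n - 1 - i) ∧
        (if Even j then c i j else c (n - i) j) + (if Even j then c (i + 1) j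
          else c (n - (i + 1)) j) = c e j + c (e + 1) j := by
      intro j i hi
      split_ifs with he
      · exact ⟨i, hi, rfl, rfl⟩
      · refine ⟨n - 1 - i, by omega, rfl, ?_⟩
        rw [add_comm, show n - (i + 1) = n - 1 - i by omega, show n - i = n - 1 - i + 1 by omega]
    obtain ⟨e, he, he1, he2⟩ := hfib j i hi
    obtain ⟨e', he', he1', he2'⟩ := hfib j' i' hi'
    simp only [he2, he2'] at hji
    have hee : e = e' := has e he e' he' (by simpa [hcπ] using congrArg π hji)
    subst hee
    have hjj : j = j' := hcadd e he j hj j' hj' hji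
    subst hjj
    refine ⟨rfl, ?_⟩
    split_ifs at he1 he1' <;> omega

/-- The vector over `ZMod 2` of the binary digits of the `j`-th entry of a list. -/
def binaryListing (r : ℕ) (L : List ℕ) (j : ℕ) : Fin r → ZMod 2 :=
  fun b => ((L.getD j 0 / 2 ^ (b : ℕ) : ℕ) : ZMod 2)

/-- The first list has one entry more than the order of the group, a repeat of its first entry,
because `p N` occurs in the closing condition. -/
theorem isStrandSystem_four : IsStrandSystem 4 (binaryListing 2 [0, 2, 2, 0, 0])
    (binaryListing 2 [1, 0, 2, 3]) (binaryListing 2 [2, 0, 3, 1]) (binaryListing 2 [3, 0, 1, 2])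
    (binaryListing 2 [1, 1, 3, 3]) := by
  constructor <;> decide

theorem isStrandSystem_eight : IsStrandSystem 8 (binaryListing 3 [0, 1, 1, 4, 4, 7, 7, 0, 0])
    (binaryListing 3 [1, 7, 5, 6, 3, 2, 4, 0]) (binaryListing 3 [2, 5, 1, 7, 6, 4, 3, 0])
    (binaryListing 3 [4, 1, 2, 5, 7, 3, 6, 0]) (binaryListing 3 [2, 2, 3, 3, 5, 5, 6, 6]) := by
  constructor <;> decide +kernel

theorem nonempty_addEquiv_of_add_self {L : Type*} [AddCommGroup L] {r : ℕ}
    (hL : Nat.card L = 2 ^ r) (h2 : ∀ x : L, x + x = 0) :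
    Nonempty ((Fin r → ZMod 2) ≃+ L) := by
  let _ : Module (ZMod 2) L := AddCommGroup.zmodModule (fun x => by rw [two_nsmul, h2])
  have : Finite L := Nat.finite_of_card_ne_zero (by rw [hL]; positivity)
  have hr : Module.finrank (ZMod 2) L = r := by
    have h := Module.natCard_eq_pow_finrank (K := ZMod 2) (V := L)
    rw [hL, Nat.card_zmod] at h
    exact (Nat.pow_right_injective le_rfl h).symm
  exact ⟨((Module.finBasisOfFinrankEq (ZMod 2) L hr).equivFun.symm).toAddEquiv⟩

theorem IsCyclicallyHarmonious.of_exponent_two_ker {A B : Type*} [AddCommGroup A] [AddCommGroup B]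
    [Finite A] (π : A →+ B) (hπ : Function.Surjective π)
    (hN : Nat.card π.ker = 4 ∨ Nat.card π.ker = 8)
    (h2 : ∀ x, π x = 0 → x + x = 0) (hB3 : 3 ≤ Nat.card B)
    (hB : IsCyclicallyHarmonious B) : IsCyclicallyHarmonious A := by
  have h2' : ∀ x : π.ker, x + x = 0 := fun x => Subtype.ext (h2 x x.2)
  rcases hN with hN | hN
  · obtain ⟨e⟩ := nonempty_addEquiv_of_add_self (r := 2) hN h2'
    exact hB.of_isStrandSystem π hπ (π.ker.subtype.comp e.toAddMonoidHom)
      (π.ker.subtype_injective.comp e.injective) (fun t => (e t).2) hN isStrandSystem_four hB3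
  · obtain ⟨e⟩ := nonempty_addEquiv_of_add_self (r := 3) hN h2'
    exact hB.of_isStrandSystem π hπ (π.ker.subtype.comp e.toAddMonoidHom)
      (π.ker.subtype_injective.comp e.injective) (fun t => (e t).2) hN isStrandSystem_eight hB3

/-! ### Explicit base cases -/

/-- The listing of `ZMod 2 × ZMod (4 * h)`, with the coordinates as integers. -/
def twoByFourListing (h k : ℕ) : ℤ × ℤ :=
  if k < 4 * h then (if 2 * h < k ∧ k % 2 = 1 then 1 else 0, k)
  else if k < 6 * h then
    if k % 2 = 0 then (1, 6 * h - 1 - k) else (0, 8 * h - k)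
  else if k < 8 * h then
    if k % 2 = 0 then (1, 8 * h - 2 - k) else (1, 10 * h - 1 - k)
  else (0, 0)

/-- The sums of consecutive entries of `twoByFourListing`, up to congruence. -/
def twoByFourSums (h k : ℕ) : ℤ × ℤ :=
  if k + 1 < 4 * h then (if 2 * h ≤ k then 1 else 0, 2 * k + 1)
  else if k + 1 = 4 * h then (0, 6 * h - 2)
  else if k + 1 < 6 * h then (1, 14 * h - 2 - 2 * k)
  else if k + 1 = 6 * h then (1, 4 * h - 1)
  else if k + 1 < 8 * h then (0, 18 * h - 4 - 2 * k)
  else (1, 2 * h)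

theorem twoByFourListing_add (h k : ℕ) (hk : k < 8 * h) :
    ((2 : ℤ) ∣ (twoByFourListing h k).1 + (twoByFourListing h (k + 1)).1 - (twoByFourSums h k).1) ∧
    (twoByFourListing h k).2 + (twoByFourListing h (k + 1)).2 = (twoByFourSums h k).2 := by
  unfold twoByFourListing twoByFourSums
  push_cast
  split_ifs <;> simp only [] <;> omega

theorem eq_of_twoByFourListing (h k l : ℕ) (hk : k < 8 * h) (hl : l < 8 * h)
    (h1 : (2 : ℤ) ∣ (twoByFourListing h k).1 - (twoByFourListing h l).1)
    (h2 : (4 * h : ℤ) ∣ (twoByFourListing h k).2 - (twoByFourListing h l).2) : k = l := by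
  have hb : ∀ k < 8 * h, 0 ≤ (twoByFourListing h k).2 ∧ (twoByFourListing h k).2 < 4 * h := by
    intro k hk
    unfold twoByFourListing
    split_ifs <;> simp only [] <;> omega
  have hz := Int.eq_zero_of_abs_lt_dvd h2 (by
    have := hb k hk
    have := hb l hl
    rw [abs_lt]; constructor <;> omega)
  clear h2 hb
  unfold twoByFourListing at h1 hz
  split_ifs at h1 hz <;> simp only [] at h1 hz <;> omega

-- The second coordinates lie in `[0, 8 * h)`, so congruent ones differ by `c * (4 * h)` with `c` in
-- `{-1, 0, 1}`; each case is linear arithmetic. Odd second coordinates arise for `k + 1 < 4 * h`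
-- and at `k + 1 = 6 * h`, even ones elsewhere.
set_option maxHeartbeats 1000000 in
theorem eq_of_twoByFourSums (h k l : ℕ) (hk : k < 8 * h) (hl : l < 8 * h)
    (h1 : (2 : ℤ) ∣ (twoByFourSums h k).1 - (twoByFourSums h l).1)
    (h2 : (4 * h : ℤ) ∣ (twoByFourSums h k).2 - (twoByFourSums h l).2) : k = l := by
  obtain ⟨c, hc⟩ := h2
  have hb : ∀ k < 8 * h, 0 ≤ (twoByFourSums h k).2 ∧ (twoByFourSums h k).2 < 8 * h := by
    intro k hk
    unfold twoByFourSums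
    split_ifs <;> simp only [] <;> omega
  have hh : (0 : ℤ) < h := by omega
  have hc1 : c < 2 := by
    have := hb k hk; have := hb l hl
    by_contra hcon
    nlinarith
  have hc2 : -2 < c := by
    have := hb k hk; have := hb l hl
    by_contra hcon
    nlinarith
  clear hb
  have hc3 : c = -1 ∨ c = 0 ∨ c = 1 := by omega
  unfold twoByFourSums at h1 hc
  rcases hc3 with rfl | rfl | rfl <;>
    split_ifs at h1 hc <;> simp only [] at h1 hc <;> omega

/-- In the first half of the listing the second coordinate climbs through all residues. The third
quarter takes the unused elements with odd second coordinate, the fourth those with even second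
coordinate. -/
theorem isCyclicallyHarmonious_zmod_two_prod (h : ℕ) (hh : 0 < h) :
    IsCyclicallyHarmonious (ZMod 2 × ZMod (4 * h)) := by
  have hcast : ∀ x y : ℤ × ℤ,
      ((x.1 : ZMod 2), (x.2 : ZMod (4 * h))) = ((y.1 : ZMod 2), (y.2 : ZMod (4 * h))) →
      (2 : ℤ) ∣ x.1 - y.1 ∧ (4 * h : ℤ) ∣ x.2 - y.2 := by
    intro x y hxy
    rw [Prod.mk.injEq, eq_comm, ZMod.intCast_eq_intCast_iff_dvd_sub,
      eq_comm, ZMod.intCast_eq_intCast_iff_dvd_sub] at hxy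
    exact_mod_cast hxy
  have hsum : ∀ k < 8 * h,
      (((twoByFourListing h k).1 : ZMod 2), ((twoByFourListing h k).2 : ZMod (4 * h))) +
      (((twoByFourListing h (k + 1)).1 : ZMod 2), ((twoByFourListing h (k + 1)).2 : ZMod (4 * h))) =
      (((twoByFourSums h k).1 : ZMod 2), ((twoByFourSums h k).2 : ZMod (4 * h))) := by
    intro k hk
    obtain ⟨h1, h2⟩ := twoByFourListing_add h k hk
    rw [Prod.mk_add_mk, ← h2]
    refine Prod.ext ?_ (by push_cast; rfl)
    simp only
    rw [← Int.cast_add, eq_comm, ZMod.intCast_eq_intCast_iff_dvd_sub]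
    exact_mod_cast h1
  refine isCyclicallyHarmonious_of_wrap (N := 8 * h) (by omega) ?_
    (fun k => (((twoByFourListing h k).1 : ZMod 2), ((twoByFourListing h k).2 : ZMod (4 * h))))
    ?_ ?_ ?_
  · rw [Nat.card_prod, Nat.card_zmod, Nat.card_zmod]; ring
  · have h1 : twoByFourListing h (8 * h) = (0, 0) := by
      unfold twoByFourListing
      rw [if_neg (by omega), if_neg (by omega), if_neg (by omega)]
    have h2 : twoByFourListing h 0 = (0, 0) := by
      unfold twoByFourListing
      rw [if_pos (by omega), if_neg (by omega)]
      rfl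
    simp only [h1, h2]
  · intro k hk l hl hkl
    obtain ⟨h1, h2⟩ := hcast _ _ hkl
    exact eq_of_twoByFourListing h k l hk hl h1 h2
  · intro k hk l hl hkl
    simp only [hsum k hk, hsum l hl] at hkl
    obtain ⟨h1, h2⟩ := hcast _ _ hkl
    exact eq_of_twoByFourSums h k l hk hl h1 h2

theorem isCyclicallyHarmonious_zmod_four_prod_zmod_four :
    IsCyclicallyHarmonious (ZMod 4 × ZMod 4) := by
  refine isCyclicallyHarmonious_of_wrap (N := 16) (by norm_num) (by simp)
    -- The default `(0, 0)`, reached at index 16, equals the first entry and closes the cycle.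
    (fun k => ([(0, 0), (2, 0), (3, 2), (2, 2), (3, 1), (3, 0), (1, 1), (1, 2), (0, 3), (0, 1),
      (2, 1), (1, 3), (2, 3), (1, 0), (3, 3), (0, 2)] : List (ZMod 4 × ZMod 4)).getD k (0, 0))
    ?_ ?_ ?_ <;> decide +kernel

theorem isCyclicallyHarmonious_zmod_two_prod_zmod_two_prod_zmod_four :
    IsCyclicallyHarmonious (ZMod 2 × ZMod 2 × ZMod 4) := by
  refine isCyclicallyHarmonious_of_wrap (N := 16) (by norm_num) (by simp)
    (fun k => ([(0, 0, 0), (1, 1, 1), (1, 1, 0), (0, 1, 0), (1, 0, 2), (0, 0, 1), (0, 1, 1),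
      (0, 1, 2), (0, 0, 3), (1, 0, 3), (1, 0, 1), (1, 1, 3), (1, 0, 0), (0, 1, 3), (1, 1, 2),
      (0, 0, 2)] : List (ZMod 2 × ZMod 2 × ZMod 4)).getD k (0, 0, 0))
    ?_ ?_ ?_ <;> decide +kernel

/-! ### Reductions between products of cyclic groups -/

section PiZMod

variable {I : Type*}

/-- Componentwise reduction `∏ ZMod (q i) → ∏ ZMod (q' i)`, where `q' i ∣ q i`. -/
def piZModReduction (q q' : I → ℕ) (h : ∀ i, q' i ∣ q i) :
    (∀ i, ZMod (q i)) →+ ∀ i, ZMod (q' i) where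
  toFun x i := ZMod.castHom (h i) (ZMod (q' i)) (x i)
  map_zero' := by ext; simp
  map_add' x y := funext fun i => map_add (ZMod.castHom (h i) (ZMod (q' i))) (x i) (y i)

theorem piZModReduction_surjective (q q' : I → ℕ) (h : ∀ i, q' i ∣ q i) :
    Function.Surjective (piZModReduction q q' h) := by
  intro y
  choose x hx using fun i => ZMod.ringHom_surjective (ZMod.castHom (h i) (ZMod (q' i))) (y i)
  exact ⟨x, funext hx⟩

theorem natCard_pi_zmod [Fintype I] (q : I → ℕ) : Nat.card (∀ i, ZMod (q i)) = ∏ i, q i := by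
  rw [Nat.card_pi]
  simp

theorem finite_pi_zmod [Fintype I] {q : I → ℕ} (hq : ∀ i, 0 < q i) : Finite (∀ i, ZMod (q i)) := by
  have := fun i => NeZero.of_pos (hq i)
  infer_instance

theorem card_ker_piZModReduction [Fintype I] {q q' : I → ℕ} (h : ∀ i, q' i ∣ q i) (hq : ∀ i, 0 < q i) {k : ℕ}
    (hk : ∏ i, q i = k * ∏ i, q' i) : Nat.card (piZModReduction q q' h).ker = k := by
  have h1 := card_eq_card_ker_mul_card _ (piZModReduction_surjective q q' h)
  rw [natCard_pi_zmod, natCard_pi_zmod, hk] at h1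
  have h2 : 0 < ∏ i, q' i := Finset.prod_pos fun i _ => Nat.pos_of_dvd_of_pos (h i) (hq i)
  exact (Nat.eq_of_mul_eq_mul_right h2 h1).symm

theorem IsCyclicallyHarmonious.pi_zmod_of_odd [Fintype I] {q q' : I → ℕ} (h : ∀ i, q' i ∣ q i)
    (hq : ∀ i, 0 < q i) {k : ℕ} (hk : ∏ i, q i = k * ∏ i, q' i) (hodd : Odd k)
    (hB : IsCyclicallyHarmonious (∀ i, ZMod (q' i))) :
    IsCyclicallyHarmonious (∀ i, ZMod (q i)) := by
  have := finite_pi_zmod hq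
  refine hB.of_odd_card_ker _ (piZModReduction_surjective q q' h) ?_
  rwa [card_ker_piZModReduction h hq hk]

theorem IsCyclicallyHarmonious.pi_zmod_of_dvd_two_mul [Fintype I] {q q' : I → ℕ} (h : ∀ i, q' i ∣ q i)
    (h' : ∀ i, q i ∣ 2 * q' i) (hq : ∀ i, 0 < q i) {k : ℕ} (hk : ∏ i, q i = k * ∏ i, q' i)
    (hk' : k = 4 ∨ k = 8) (h3 : 3 ≤ ∏ i, q' i)
    (hB : IsCyclicallyHarmonious (∀ i, ZMod (q' i))) :
    IsCyclicallyHarmonious (∀ i, ZMod (q i)) := by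
  have := finite_pi_zmod hq
  refine hB.of_exponent_two_ker _ (piZModReduction_surjective q q' h) ?_ ?_ ?_
  · rwa [card_ker_piZModReduction h hq hk]
  · intro x hx
    funext i
    have := NeZero.of_pos (hq i)
    have h1 : ((x i).val : ZMod (q' i)) = 0 := by
      have := congrFun hx i
      simpa [piZModReduction, ZMod.natCast_val] using this
    rw [ZMod.natCast_eq_zero_iff] at h1
    have h2 : q i ∣ 2 * (x i).val := (h' i).trans (Nat.mul_dvd_mul_left 2 h1)
    rw [← ZMod.natCast_eq_zero_iff] at h2
    simpa [two_mul] using h2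
  · rwa [natCard_pi_zmod]

theorem IsCyclicallyHarmonious.pi_zmod_of_pair {q : I → ℕ} {i k : I} (hik : i ≠ k)
    (h1 : ∀ x, x ≠ i → x ≠ k → q x = 1) (h : IsCyclicallyHarmonious (ZMod (q i) × ZMod (q k))) :
    IsCyclicallyHarmonious (∀ x, ZMod (q x)) := by
  classical
  refine h.of_addEquiv (AddEquiv.ofBijective ((Pi.evalAddMonoidHom (fun x => ZMod (q x)) i).prod
    (Pi.evalAddMonoidHom (fun x => ZMod (q x)) k)) ⟨?_, ?_⟩)
  · intro x y hxy
    simp only [AddMonoidHom.prod_apply, Pi.evalAddMonoidHom_apply, Prod.mk.injEq] at hxy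
    funext z
    by_cases hzi : z = i
    · exact hzi ▸ hxy.1
    by_cases hzk : z = k
    · exact hzk ▸ hxy.2
    have : Subsingleton (ZMod (q z)) := by rw [h1 z hzi hzk]; infer_instance
    exact Subsingleton.elim _ _
  · rintro ⟨a, b⟩
    refine ⟨Pi.single i a + Pi.single k b, ?_⟩
    simp [Pi.single_eq_of_ne hik, Pi.single_eq_of_ne hik.symm]

theorem IsCyclicallyHarmonious.pi_zmod_of_triple {q : I → ℕ} {i l k : I} (hil : i ≠ l)
    (hik : i ≠ k) (hlk : l ≠ k) (h1 : ∀ x, x ≠ i → x ≠ l → x ≠ k → q x = 1)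
    (h : IsCyclicallyHarmonious (ZMod (q i) × ZMod (q l) × ZMod (q k))) :
    IsCyclicallyHarmonious (∀ x, ZMod (q x)) := by
  classical
  refine h.of_addEquiv (AddEquiv.ofBijective ((Pi.evalAddMonoidHom (fun x => ZMod (q x)) i).prod
    ((Pi.evalAddMonoidHom (fun x => ZMod (q x)) l).prod
    (Pi.evalAddMonoidHom (fun x => ZMod (q x)) k))) ⟨?_, ?_⟩)
  · intro x y hxy
    simp only [AddMonoidHom.prod_apply, Pi.evalAddMonoidHom_apply, Prod.mk.injEq] at hxy
    funext z
    by_cases hzi : z = i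
    · exact hzi ▸ hxy.1
    by_cases hzl : z = l
    · exact hzl ▸ hxy.2.1
    by_cases hzk : z = k
    · exact hzk ▸ hxy.2.2
    have : Subsingleton (ZMod (q z)) := by rw [h1 z hzi hzl hzk]; infer_instance
    exact Subsingleton.elim _ _
  · rintro ⟨a, b, c⟩
    refine ⟨Pi.single i a + Pi.single l b + Pi.single k c, ?_⟩
    simp [Pi.single_eq_of_ne hik, Pi.single_eq_of_ne hik.symm, Pi.single_eq_of_ne hil,
      Pi.single_eq_of_ne hil.symm, Pi.single_eq_of_ne hlk, Pi.single_eq_of_ne hlk.symm]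

/-- Lowering two exponents by one is a reduction with kernel of order 4. It is repeated as long as
some exponent at least 2 and another positive one survive. -/
theorem isCyclicallyHarmonious_pi_zmod_two_pow [Fintype I] (e : I → ℕ)
    (he : ∃ k i, i ≠ k ∧ 2 ≤ e k ∧ 1 ≤ e i) : IsCyclicallyHarmonious (∀ x, ZMod (2 ^ e x)) := by
  classical
  induction hs : ∑ x, e x using Nat.strong_induction_on generalizing e with
  | _ s ih =>
  subst hs
  by_cases hstep : ∃ i j, i ≠ j ∧ 1 ≤ e i ∧ 1 ≤ e j ∧ ∃ k l, l ≠ k ∧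
      2 ≤ (if k = i ∨ k = j then e k - 1 else e k) ∧ 1 ≤ (if l = i ∨ l = j then e l - 1 else e l)
  · obtain ⟨i, j, hij, hi, hj, k, l, hlk, hk, hl⟩ := hstep
    set e' : I → ℕ := fun x => if x = i ∨ x = j then e x - 1 else e x with he'
    have hle : ∀ x, e' x ≤ e x ∧ e x ≤ e' x + 1 := by
      intro x
      simp only [he']
      split_ifs <;> omega
    have hsum : ∑ x, e x = 2 + ∑ x, e' x := by
      have h1 : ∀ x, e x = (if x ∈ ({i, j} : Finset I) then 1 else 0) + e' x := by
        intro x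
        simp only [he', Finset.mem_insert, Finset.mem_singleton]
        split_ifs with h
        · rcases h with rfl | rfl <;> omega
        · omega
      rw [Finset.sum_congr rfl fun x _ => h1 x, Finset.sum_add_distrib, Finset.sum_ite_mem,
        Finset.univ_inter, Finset.sum_const, Finset.card_pair hij, smul_eq_mul, mul_one]
    have hcard : 2 + 1 ≤ ∑ x, e' x := by
      have := Finset.add_le_sum (s := Finset.univ) (f := e') (fun x _ => Nat.zero_le _)
        (Finset.mem_univ k) (Finset.mem_univ l) hlk.symm
      exact le_trans (add_le_add hk hl) this
    refine IsCyclicallyHarmonious.pi_zmod_of_dvd_two_mul (q' := fun x => 2 ^ e' x) (k := 4)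
      (fun x => Nat.pow_dvd_pow 2 (hle x).1) (fun x => ?_) (fun x => by positivity) ?_ (Or.inl rfl)
      ?_ (ih _ (by omega) e' ⟨k, l, hlk, hk, hl⟩ rfl)
    · rw [← pow_succ']
      exact Nat.pow_dvd_pow 2 (hle x).2
    · rw [Finset.prod_pow_eq_pow_sum, Finset.prod_pow_eq_pow_sum, hsum, pow_add]
      norm_num
    · rw [Finset.prod_pow_eq_pow_sum]
      calc 3 ≤ 2 ^ (2 + 1) := by norm_num
        _ ≤ _ := Nat.pow_le_pow_right (by norm_num) hcard
  have hno : ∀ i j k l, i ≠ j → 1 ≤ e i → 1 ≤ e j → l ≠ k →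
      2 ≤ (if k = i ∨ k = j then e k - 1 else e k) →
      1 ≤ (if l = i ∨ l = j then e l - 1 else e l) → False :=
    fun i j k l h1 h2 h3 h4 h5 h6 => hstep ⟨i, j, h1, h2, h3, k, l, h4, h5, h6⟩
  clear hstep ih
  -- No admissible reduction is left, which forces the positive exponents to be `2, 1, 1`, or `2,
  -- 2`, or `1` together with an arbitrary exponent at least 2.
  obtain ⟨k, i, hik, hk, hi⟩ := he
  by_cases hl : ∃ l, l ≠ i ∧ l ≠ k ∧ 1 ≤ e l
  · obtain ⟨l, hli, hlk, hl⟩ := hl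
    have h0 : ∀ x, x ≠ i → x ≠ l → x ≠ k → e x = 0 := by
      intro x hxi hxl hxk
      by_contra hx
      exact hno l x k i hxl.symm hl (by omega) hik
        (by rw [if_neg (by simp [hlk.symm, hxk.symm])]; omega)
        (by rw [if_neg (by simp [hli.symm, hxi.symm])]; omega)
    have hl1 : e l = 1 := by
      by_contra hne
      exact hno i l k l hli.symm hi hl hlk
        (by rw [if_neg (by simp [hlk.symm, hik.symm])]; omega) (by rw [if_pos (by simp)]; omega)
    have hi1 : e i = 1 := by
      by_contra hne
      exact hno i l k i hli.symm hi hl hik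
        (by rw [if_neg (by simp [hlk.symm, hik.symm])]; omega) (by rw [if_pos (by simp)]; omega)
    have hk2 : e k = 2 := by
      by_contra hne
      exact hno i k k l hik hi (by omega) hlk
        (by rw [if_pos (by simp)]; omega) (by rw [if_neg (by simp [hli, hlk])]; omega)
    refine IsCyclicallyHarmonious.pi_zmod_of_triple hli.symm hik hlk
      (fun x h1 h2 h3 => by rw [h0 x h1 h2 h3, pow_zero]) ?_
    rw [hl1, hi1, hk2]
    exact isCyclicallyHarmonious_zmod_two_prod_zmod_two_prod_zmod_four
  · push Not at hl
    have h0 : ∀ x, x ≠ i → x ≠ k → 2 ^ e x = 1 := by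
      intro x h1 h2
      have := hl x h1 h2
      rw [show e x = 0 by omega, pow_zero]
    refine IsCyclicallyHarmonious.pi_zmod_of_pair hik h0 ?_
    by_cases hi1 : e i = 1
    · rw [hi1, show e k = 2 + (e k - 2) by omega, pow_add]
      exact isCyclicallyHarmonious_zmod_two_prod _ (by positivity)
    · have hk2 : e k = 2 := by
        by_contra hne
        exact hno i k k i hik hi (by omega) hik
          (by rw [if_pos (by simp)]; omega) (by rw [if_pos (by simp)]; omega)
      have hi2 : e i = 2 := by
        by_contra hne
        exact hno i k i k hik hi (by omega) hik.symm
          (by rw [if_pos (by simp)]; omega) (by rw [if_pos (by simp)]; omega)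
      rw [hk2, hi2]
      exact isCyclicallyHarmonious_zmod_four_prod_zmod_four

theorem prod_eq_prod_mul_prod_ite_one [Fintype I] [DecidableEq I] (q : I → ℕ) (D : Finset I) :
    ∏ x, q x = (∏ x ∈ D, q x) * ∏ x, if x ∈ D then 1 else q x := by
  rw [← Finset.univ_inter D, ← Finset.prod_ite_mem, ← Finset.prod_mul_distrib]
  refine Finset.prod_congr rfl fun x _ => ?_
  by_cases h : x ∈ D <;> simp [h]

/-- Factors of order 2 are removed in pairs until two or three remain, and these are removed
together, leaving odd order. Kernels of order 8 are needed because a single factor of order 2 must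
not remain: the consecutive sums would add up to twice the sum of all elements, which is `0`,
whereas the elements add up to the unique involution. -/
theorem isCyclicallyHarmonious_pi_zmod_of_two_or_odd [Fintype I] (q : I → ℕ) (hq : ∀ x, q x = 2 ∨ Odd (q x))
    (h2 : ∃ i j, i ≠ j ∧ q i = 2 ∧ q j = 2) (h3 : ∃ k, 3 ≤ q k ∧ Odd (q k)) :
    IsCyclicallyHarmonious (∀ x, ZMod (q x)) := by
  classical
  induction hs : (Finset.univ.filter fun x => q x = 2).card using Nat.strong_induction_on
    generalizing q with
  | _ s ih =>
  subst hs
  set E := Finset.univ.filter fun x => q x = 2 with hE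
  have hEq : ∀ x, x ∈ E ↔ q x = 2 := by simp [hE]
  have hpos : ∀ x, 0 < q x := fun x => by
    rcases hq x with h | h
    · omega
    · exact h.pos
  have hE2 : 2 ≤ E.card := by
    obtain ⟨i, j, hij, hi, hj⟩ := h2
    exact Finset.one_lt_card.mpr ⟨i, (hEq i).2 hi, j, (hEq j).2 hj, hij⟩
  obtain ⟨k, hk3, hko⟩ := h3
  have hred : ∀ D ⊆ E, (D.card = 2 ∨ D.card = 3) →
      IsCyclicallyHarmonious (∀ x, ZMod (if x ∈ D then 1 else q x)) →
      IsCyclicallyHarmonious (∀ x, ZMod (q x)) := by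
    intro D hD hDc hB
    have hD2 : ∀ x ∈ D, q x = 2 := fun x hx => (hEq x).1 (hD hx)
    refine IsCyclicallyHarmonious.pi_zmod_of_dvd_two_mul
      (q' := fun x => if x ∈ D then 1 else q x) (k := 2 ^ D.card) ?_ ?_ hpos ?_ ?_ ?_ hB
    · intro x
      split_ifs <;> simp
    · intro x
      split_ifs with hx
      · simp [hD2 x hx]
      · exact Dvd.intro_left _ rfl
    · rw [prod_eq_prod_mul_prod_ite_one q D, Finset.prod_congr rfl hD2, Finset.prod_const]
    · rcases hDc with h | h <;> simp [h]
    -- The odd factor at `k` survives and keeps the quotient at order 3 or more, as strand systems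
    -- require.
    · have hkD : k ∉ D := fun h => by have := hD2 k h; omega
      refine hk3.trans (Nat.le_of_dvd (Finset.prod_pos fun x _ => ?_) ?_)
      · split_ifs
        · exact one_pos
        · exact hpos x
      · have := Finset.dvd_prod_of_mem (fun x => if x ∈ D then 1 else q x) (Finset.mem_univ k)
        simpa only [if_neg hkD] using this
  by_cases h4 : E.card ≤ 3
  · refine hred E subset_rfl (by omega) (isCyclicallyHarmonious_of_odd_card ?_)
    rw [natCard_pi_zmod]
    refine Finset.prod_induction _ Odd (fun a b => Odd.mul) odd_one fun x _ => ?_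
    split_ifs with hx
    · exact odd_one
    · exact (hq x).resolve_left fun h => hx ((hEq x).2 h)
  · obtain ⟨D, hD, hDc⟩ := Finset.exists_subset_card_eq hE2
    have hE' : (Finset.univ.filter fun x => (if x ∈ D then 1 else q x) = 2) = E \ D := by
      ext x
      simp only [Finset.mem_filter, Finset.mem_univ, true_and, Finset.mem_sdiff, hEq]
      split_ifs with h <;> simp [h]
    have hc : (E \ D).card = E.card - 2 := by rw [Finset.card_sdiff_of_subset hD, hDc]
    refine hred D hD (Or.inl hDc) (ih _ ?_ (fun x => if x ∈ D then 1 else q x) ?_ ?_ ?_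
      (congrArg Finset.card hE'))
    · omega
    · intro x
      split_ifs
      · exact Or.inr odd_one
      · exact hq x
    · obtain ⟨i, hi, j, hj, hij⟩ := Finset.one_lt_card.mp (show 1 < (E \ D).card by omega)
      rw [Finset.mem_sdiff, hEq] at hi hj
      exact ⟨i, j, hij, by rw [if_neg hi.2, hi.1], by rw [if_neg hj.2, hj.1]⟩
    · have hkD : k ∉ D := fun h => by have := (hEq k).1 (hD h); omega
      exact ⟨k, by rwa [if_neg hkD], by rwa [if_neg hkD]⟩

/-- If some even factor exceeds 2, all odd factors are discarded through a kernel of odd order and a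
2-group remains. Otherwise every even factor is 2, and the factor at least 3 is odd. -/
theorem isCyclicallyHarmonious_pi_zmod [Fintype I] (q : I → ℕ) (hq : ∀ x, Odd (q x) ∨ ∃ e, q x = 2 ^ e)
    (h2 : ∃ i j, i ≠ j ∧ ¬ Odd (q i) ∧ ¬ Odd (q j)) (h3 : ∃ k, 3 ≤ q k) :
    IsCyclicallyHarmonious (∀ x, ZMod (q x)) := by
  classical
  have hpos : ∀ x, 0 < q x := fun x => by
    rcases hq x with h | ⟨e, h⟩
    · exact h.pos
    · rw [h]; positivity
  by_cases hk : ∃ k, 3 ≤ q k ∧ ¬ Odd (q k)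
  · obtain ⟨k, hk3, hko⟩ := hk
    obtain ⟨i, hik, hi⟩ : ∃ i, i ≠ k ∧ ¬ Odd (q i) := by
      obtain ⟨i, j, hij, hi, hj⟩ := h2
      by_cases h : i = k
      · exact ⟨j, fun h' => hij (h.trans h'.symm), hj⟩
      · exact ⟨i, h, hi⟩
    set D := Finset.univ.filter fun x => Odd (q x) with hD
    have hDq : ∀ x, x ∈ D ↔ Odd (q x) := by simp [hD]
    have hex : ∀ x, ∃ e, (if x ∈ D then 1 else q x) = 2 ^ e := by
      intro x
      split_ifs with hx
      · exact ⟨0, rfl⟩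
      · exact (hq x).resolve_left fun h => hx ((hDq x).2 h)
    choose e he using hex
    refine IsCyclicallyHarmonious.pi_zmod_of_odd (q' := fun x => if x ∈ D then 1 else q x) ?_ hpos
      (prod_eq_prod_mul_prod_ite_one q D) ?_ ?_
    · intro x
      split_ifs <;> simp
    · exact Finset.prod_induction _ Odd (fun a b => Odd.mul) odd_one fun x hx => (hDq x).1 hx
    -- The moduli are abstracted so that they can be replaced by powers of 2 inside the dependent
    -- product.
    · suffices hsuff : ∀ q' : I → ℕ, q' = (fun x => 2 ^ e x) →
          IsCyclicallyHarmonious (∀ x, ZMod (q' x)) from hsuff _ (funext he)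
      rintro _ rfl
      have hek := he k
      have hei := he i
      rw [if_neg (fun h => hko ((hDq k).1 h))] at hek
      rw [if_neg (fun h => hi ((hDq i).1 h))] at hei
      refine isCyclicallyHarmonious_pi_zmod_two_pow e ⟨k, i, hik, ?_, ?_⟩
      · by_contra hlt
        have : e k = 0 ∨ e k = 1 := by omega
        rcases this with h | h <;> rw [h] at hek <;> omega
      · by_contra hlt
        rw [show e i = 0 by omega, pow_zero] at hei
        exact hi (hei ▸ odd_one)
  · push Not at hk
    have h2' : ∀ x, ¬ Odd (q x) → q x = 2 := by
      intro x hx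
      have h1 : ¬ 3 ≤ q x := fun h => hx (hk x h)
      have h2 := hpos x
      have h3 : q x ≠ 1 := fun h => hx (h ▸ odd_one)
      omega
    obtain ⟨i, j, hij, hi, hj⟩ := h2
    obtain ⟨k, hk3⟩ := h3
    exact isCyclicallyHarmonious_pi_zmod_of_two_or_odd q
      (fun x => or_iff_not_imp_right.mpr (h2' x)) ⟨i, j, hij, h2' i hi, h2' j hj⟩ ⟨k, hk3, hk k hk3⟩

end PiZMod

/-! ### From involutions to the even case -/

theorem ZMod.eq_of_add_self_eq_zero {q : ℕ} (hq : 0 < q) {x y : ZMod q} (hx : x + x = 0)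
    (hy : y + y = 0) (hx0 : x ≠ 0) (hy0 : y ≠ 0) : x = y := by
  have := NeZero.of_pos hq
  have key : ∀ z : ZMod q, z + z = 0 → z ≠ 0 → 2 * z.val = q := by
    intro z hz hz0
    have h1 : ((2 * z.val : ℕ) : ZMod q) = 0 := by simp [two_mul, hz]
    obtain ⟨c, hc⟩ := (ZMod.natCast_eq_zero_iff _ _).1 h1
    have h2 := ZMod.val_lt z
    have h3 : 0 < z.val := Nat.pos_of_ne_zero fun h => hz0 ((ZMod.val_eq_zero z).1 h)
    have h4 : c = 1 := by
      have : c < 2 := by by_contra hcon; nlinarith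
      have : c ≠ 0 := by rintro rfl; omega
      omega
    rw [hc, h4, mul_one]
  apply ZMod.val_injective
  have := key x hx hx0
  have := key y hy hy0
  omega

theorem ZMod.eq_zero_of_add_self_eq_zero {q : ℕ} (hq : Odd q) {x : ZMod q} (hx : x + x = 0) :
    x = 0 := by
  have h : Odd (Nat.card (ZMod q)) := by rwa [Nat.card_zmod]
  exact two_nsmul_injective_of_odd_card h (by rw [hx, add_zero])

/-- A finite abelian group with two distinct elements of order two and an element whose double is
nonzero is cyclically harmonious. -/
theorem isCyclicallyHarmonious_of_two_involutions {A : Type*} [AddCommGroup A] [Finite A]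
    {x y z : A} (hx : x + x = 0) (hy : y + y = 0) (hx0 : x ≠ 0) (hy0 : y ≠ 0) (hxy : x ≠ y)
    (hz : z + z ≠ 0) : IsCyclicallyHarmonious A := by
  classical
  obtain ⟨I, _, p, hp, e, ⟨φ⟩⟩ := AddCommGroup.equiv_directSum_zmod_of_finite A
  let ψ : A ≃+ ∀ i, ZMod (p i ^ e i) := φ.trans (DirectSum.addEquivProd _)
  have hpos : ∀ i, 0 < p i ^ e i := fun i => pow_pos (hp i).pos _
  refine IsCyclicallyHarmonious.of_addEquiv ψ (isCyclicallyHarmonious_pi_zmod _ ?_ ?_ ?_)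
  · intro i
    rcases (hp i).eq_two_or_odd' with h | h
    · exact Or.inr ⟨e i, by rw [h]⟩
    · exact Or.inl h.pow
  -- With at most one even factor there would be at most one involution, since a cyclic group has at
  -- most one and a group of odd order has none.
  · by_contra hcon
    push Not at hcon
    have hdouble : ∀ {w : A}, w + w = 0 → ∀ i, ψ w i + ψ w i = 0 := by
      intro w hw i
      rw [← Pi.add_apply, ← map_add, hw, map_zero, Pi.zero_apply]
    have hne : ∀ {w : A}, w + w = 0 → w ≠ 0 → ∃ i, ψ w i ≠ 0 ∧ ¬ Odd (p i ^ e i) := by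
      intro w hw hw0
      by_contra hall
      push Not at hall
      refine hw0 (ψ.injective ?_)
      rw [map_zero]
      funext i
      by_contra hi
      exact hi (ZMod.eq_zero_of_add_self_eq_zero (hall i hi) (hdouble hw i))
    obtain ⟨i, hxi, hio⟩ := hne hx hx0
    obtain ⟨j, hyj, hjo⟩ := hne hy hy0
    have hij : i = j := by
      by_contra hij
      exact hjo (hcon i j hij hio)
    subst hij
    refine hxy (ψ.injective (funext fun k => ?_))
    by_cases hk : i = k
    · subst hk
      exact ZMod.eq_of_add_self_eq_zero (hpos i) (hdouble hx i) (hdouble hy i) hxi hyj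
    · rw [ZMod.eq_zero_of_add_self_eq_zero (hcon i k hk hio) (hdouble hx k),
        ZMod.eq_zero_of_add_self_eq_zero (hcon i k hk hio) (hdouble hy k)]
  · by_contra hcon
    push Not at hcon
    refine hz (ψ.injective ?_)
    rw [map_add, map_zero]
    funext i
    have h1 := hcon i
    have h2 := hpos i
    have h3 : p i ^ e i ∣ 2 := by
      have : p i ^ e i = 1 ∨ p i ^ e i = 2 := by omega
      rcases this with h | h <;> simp [h]
    rw [Pi.add_apply, Pi.zero_apply, ← two_mul]
    have h4 := (ZMod.natCast_eq_zero_iff 2 (p i ^ e i)).2 h3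
    rw [Nat.cast_ofNat] at h4
    rw [h4, zero_mul]

/-- For even `n`, the copy of `ZMod 2 × ZMod (2 * s)` supplies the involutions `(1, 0)` and `(0,
s)`; the double of `(0, 1)` is nonzero because `2 * s ≥ 4`. -/
theorem SatisfiesCycleCondition.isCyclicallyHarmonious {n : ℕ} {A : Type*} [AddCommGroup A]
    (hn : 0 < n) (h : SatisfiesCycleCondition n A) : IsCyclicallyHarmonious A := by
  obtain ⟨hA, hodd | ⟨-, s, hs, K, ⟨φ⟩⟩⟩ := h
  · exact isCyclicallyHarmonious_of_odd_card (hA ▸ hodd)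
  have : Finite A := Nat.finite_of_card_ne_zero (by omega)
  let ψ : ZMod 2 × ZMod (2 * s) →+ A := K.subtype.comp φ.symm.toAddMonoidHom
  have hψ : Function.Injective ψ := K.subtype_injective.comp φ.symm.injective
  have h11 : (1 : ZMod 2) + 1 = 0 := by decide
  have hss : ((s : ℕ) : ZMod (2 * s)) + (s : ℕ) = 0 := by
    rw [← Nat.cast_add, ← two_mul, ZMod.natCast_self]
  have hs0 : ((s : ℕ) : ZMod (2 * s)) ≠ 0 := by
    rw [Ne, ZMod.natCast_eq_zero_iff]
    exact fun h => by have := Nat.le_of_dvd (by omega) h; omega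
  have h20 : (1 : ZMod (2 * s)) + 1 ≠ 0 := by
    have : ((2 : ℕ) : ZMod (2 * s)) ≠ 0 := by
      rw [Ne, ZMod.natCast_eq_zero_iff]
      exact fun h => by have := Nat.le_of_dvd (by omega) h; omega
    rwa [one_add_one_eq_two]
  refine isCyclicallyHarmonious_of_two_involutions (x := ψ (1, 0)) (y := ψ (0, (s : ℕ)))
    (z := ψ (0, 1)) ?_ ?_ ?_ ?_ ?_ ?_
  · rw [← map_add, Prod.mk_add_mk, h11, add_zero]
    exact map_zero ψ
  · rw [← map_add, Prod.mk_add_mk, hss, add_zero]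
    exact map_zero ψ
  · rw [Ne, map_eq_zero_iff ψ hψ]
    simp
  · rw [Ne, map_eq_zero_iff ψ hψ]
    simpa using hs0
  · rw [Ne, hψ.eq_iff]
    simp
  · rw [← map_add, Ne, map_eq_zero_iff ψ hψ]
    simpa using h20

/-! ### Edges of the web and the labeling -/

theorem modEq_of_periodic {A : Type*} {n : ℕ} (hn : 0 < n) {b : ℕ → A}
    (hp : ∀ k, b (k + n) = b k) (hb : ∀ k < n, ∀ l < n, b k = b l → k = l) {x y : ℕ}
    (h : b x = b y) : x ≡ y [MOD n] := by
  have hper : Function.Periodic b n := hp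
  rw [← hper.map_mod_nat x, ← hper.map_mod_nat y] at h
  exact hb _ (Nat.mod_lt _ hn) _ (Nat.mod_lt _ hn) h

/-- The vertex of the web in the `j`-th copy of the cycle at position `i`, with both read modulo
the respective size. -/
def webVertex (m n : ℕ) [NeZero m] [NeZero n] (j i : ℕ) : Option (Fin m × Fin n) :=
  some (Fin.ofNat m j, Fin.ofNat n i)

/-- The edges of the generalized closed web, arranged in `2 * m` classes of `n` edges: the cycles in
the even classes, the edges between consecutive cycles in the odd ones, and the edges at the
apex in the last one. -/
def webEdge (m n : ℕ) [NeZero m] [NeZero n] (t i : ℕ) : Sym2 (Option (Fin m × Fin n)) :=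
  if t + 1 = 2 * m then s(none, webVertex m n 0 i)
  else if Even t then s(webVertex m n (t / 2) i, webVertex m n (t / 2) (i + 1))
  else s(webVertex m n (t / 2) i, webVertex m n (t / 2 + 1) i)

theorem Fin.val_ofNat_succ_sub {n : ℕ} [NeZero n] (hn : 2 ≤ n) {i : ℕ} (hi : i < n) :
    (Fin.ofNat n (i + 1) - Fin.ofNat n i).val = 1 := by
  rw [Fin.sub_def]
  simp only [Fin.ofNat, Nat.mod_eq_of_lt hi]
  rcases (Nat.succ_le_of_lt hi).lt_or_eq with h | h
  · rw [Nat.mod_eq_of_lt h, show n - i + (i + 1) = 1 + n by omega, Nat.add_mod_right,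
      Nat.mod_eq_of_lt (by omega)]
  · have h' : i + 1 = n := h
    rw [h', Nat.mod_self, show n - i + 0 = 1 by omega, Nat.mod_eq_of_lt (by omega)]

theorem Fin.eq_ofNat_succ_of_val_sub {n : ℕ} [NeZero n] {i i' : Fin n} (h : (i' - i).val = 1) :
    i' = Fin.ofNat n (i.val + 1) := by
  apply Fin.ext
  rw [Fin.sub_def] at h
  simp only [Fin.ofNat] at h ⊢
  have hi := i.2
  have hi' := i'.2
  by_cases hlt : n - i.val + i'.val < n
  · rw [Nat.mod_eq_of_lt hlt] at h
    rw [show i.val + 1 = n by omega, Nat.mod_self]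
    omega
  · rw [Nat.mod_eq_sub_mod (by omega), Nat.mod_eq_of_lt (by omega)] at h
    rw [Nat.mod_eq_of_lt (by omega)]
    omega

theorem webEdge_mem_edgeSet {m n : ℕ} [NeZero m] [NeZero n] (hn : 2 ≤ n) {t i : ℕ}
    (ht : t < 2 * m) (hi : i < n) : webEdge m n t i ∈ (generalizedClosedWeb m n).edgeSet := by
  unfold webEdge
  split_ifs with h1 h2
  · rw [SimpleGraph.mem_edgeSet]
    change (Fin.ofNat m 0).val = 0
    simp
  · rw [SimpleGraph.mem_edgeSet]
    change (generalizedPrism m n).Adj _ _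
    refine SimpleGraph.boxProd_adj.mpr (Or.inr ⟨?_, rfl⟩)
    rw [SimpleGraph.cycleGraph_adj']
    exact Or.inr (Fin.val_ofNat_succ_sub hn hi)
  · rw [SimpleGraph.mem_edgeSet]
    change (generalizedPrism m n).Adj _ _
    refine SimpleGraph.boxProd_adj.mpr (Or.inl ⟨?_, rfl⟩)
    rw [SimpleGraph.pathGraph_adj]
    rw [Nat.even_iff] at h2
    simp only [Fin.ofNat]
    rw [Nat.mod_eq_of_lt (by omega), Nat.mod_eq_of_lt (by omega)]
    exact Or.inl rfl

theorem webVertex_val {m n : ℕ} [NeZero m] [NeZero n] (j : Fin m) (i : Fin n) :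
    webVertex m n j i = some (j, i) := by
  simp [webVertex, Fin.ofNat, Nat.mod_eq_of_lt]

theorem exists_eq_webEdge {m n : ℕ} [NeZero m] [NeZero n] {e : Sym2 (Option (Fin m × Fin n))}
    (he : e ∈ (generalizedClosedWeb m n).edgeSet) :
    ∃ t < 2 * m, ∃ i < n, e = webEdge m n t i := by
  have hm : 0 < m := NeZero.pos m
  have hstar : ∀ x : Fin m × Fin n, x.1.val = 0 →
      ∃ t < 2 * m, ∃ i < n, s(none, some x) = webEdge m n t i := by
    rintro ⟨j, i⟩ hj
    refine ⟨2 * m - 1, by omega, i, i.2, ?_⟩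
    rw [webEdge, if_pos (by omega), ← webVertex_val, show (j : ℕ) = 0 from hj]
  have hpath : ∀ (j j' : Fin m) (i : Fin n), j.val + 1 = j'.val →
      ∃ t < 2 * m, ∃ k < n, s(some (j, i), some (j', i)) = webEdge m n t k := by
    intro j j' i hj
    have := j'.2
    refine ⟨2 * j + 1, by omega, i, i.2, ?_⟩
    rw [webEdge, if_neg (by omega), if_neg (by simp), show (2 * j.val + 1) / 2 = j by omega,
      ← webVertex_val, ← webVertex_val, hj]
  have hcycle : ∀ (j : Fin m) (i i' : Fin n), (i' - i).val = 1 →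
      ∃ t < 2 * m, ∃ k < n, s(some (j, i), some (j, i')) = webEdge m n t k := by
    intro j i i' hi
    have := j.2
    refine ⟨2 * j, by omega, i, i.2, ?_⟩
    rw [webEdge, if_neg (by omega), if_pos (by simp), show (2 * j.val) / 2 = j by omega,
      ← webVertex_val, Fin.eq_ofNat_succ_of_val_sub hi]
    simp [webVertex, Fin.ofNat, Nat.mod_eq_of_lt]
  induction e using Sym2.ind with
  | _ x y =>
    rw [SimpleGraph.mem_edgeSet] at he
    rcases x with _ | ⟨j, i⟩ <;> rcases y with _ | ⟨j', i'⟩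
    · exact he.elim
    · exact hstar _ he
    · rw [Sym2.eq_swap]
      exact hstar _ he
    · have he' : (generalizedPrism m n).Adj (j, i) (j', i') := he
      rw [generalizedPrism, SimpleGraph.boxProd_adj, SimpleGraph.pathGraph_adj,
        SimpleGraph.cycleGraph_adj'] at he'
      rcases he' with ⟨h | h, h'⟩ | ⟨h | h, h'⟩ <;> simp only at h h' <;> subst h'
      · exact hpath _ _ _ h
      · rw [Sym2.eq_swap]
        exact hpath _ _ _ h
      · rw [Sym2.eq_swap]
        exact hcycle _ _ _ h
      · exact hcycle _ _ _ h

theorem mainTheorem4 {Γ : Type*} [AddCommGroup Γ] (m n : ℕ) (hn : 3 ≤ n) (hm : 2 ≤ m)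
    (hΓ : Nat.card Γ = 2 * m * n) (H : AddSubgroup Γ) (hH : SatisfiesCycleCondition n H)
    (hcyc : IsAddCyclic (Γ ⧸ H)) :
    IsHarmonious Γ (generalizedClosedWeb m n) := by
  have hn0 : 0 < n := by omega
  have : NeZero m := ⟨by omega⟩
  have : NeZero n := ⟨by omega⟩
  have hΓ0 : 0 < Nat.card Γ := by rw [hΓ]; positivity
  have : Finite Γ := Nat.finite_of_card_ne_zero hΓ0.ne'
  have hHn : Nat.card H = n := hH.1
  obtain ⟨a, hap, ha, has⟩ := hH.isCyclicallyHarmonious hn0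
  rw [hHn] at hap ha has
  have hquot : Nat.card (Γ ⧸ H) = 2 * m := by
    have h := H.card_eq_card_quotient_mul_card_addSubgroup
    rw [hΓ, hHn] at h
    exact (Nat.eq_of_mul_eq_mul_right hn0 h).symm
  obtain ⟨gbar, hgbar⟩ := hcyc.exists_generator
  obtain ⟨g, rfl⟩ := QuotientAddGroup.mk_surjective gbar
  have hord : addOrderOf (g : Γ ⧸ H) = 2 * m := by
    rw [addOrderOf_eq_card_of_forall_mem_zmultiples hgbar, hquot]
  have hcoset : ∀ t < 2 * m, ∀ t' < 2 * m, ∀ h h' : H, t • g + h = t' • g + h' →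
      t = t' ∧ h = h' := by
    intro t ht t' ht' h h' heq
    have h1 : t • (g : Γ ⧸ H) = t' • (g : Γ ⧸ H) := by
      have := congrArg (QuotientAddGroup.mk (s := H)) heq
      simpa [(QuotientAddGroup.eq_zero_iff _).2 h.2, (QuotientAddGroup.eq_zero_iff _).2 h'.2]
        using this
    have h2 : t = t' := nsmul_injOn_Iio_addOrderOf (hord ▸ ht) (hord ▸ ht') h1
    subst h2
    exact ⟨rfl, Subtype.ext (add_left_cancel heq)⟩
  have hinj : ∀ c, ∀ i < n, ∀ i' < n, a (i + c) = a (i' + c) → i = i' := by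
    intro c i hi i' hi' h
    exact (Nat.ModEq.add_right_cancel' c (modEq_of_periodic hn0 hap ha h)).eq_of_lt_of_lt hi hi'
  have hsinj : ∀ c, ∀ i < n, ∀ i' < n,
      a (i + c) + a (i + c + 1) = a (i' + c) + a (i' + c + 1) → i = i' := by
    intro c i hi i' hi' h
    refine (Nat.ModEq.add_right_cancel' c (modEq_of_periodic (b := fun k => a k + a (k + 1)) hn0
      (fun k => ?_) has h)).eq_of_lt_of_lt hi hi'
    simp only [hap, show k + n + 1 = k + 1 + n by ring]
  -- The apex coset `2 * m - 1` differs from the cosets `0, …, m - 1` of the cycles. As the top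
  -- cycle lies in coset `0`, the apex edges fall in coset `2 * m - 1`, the only one that cycles and
  -- rungs miss.
  let f : Option (Fin m × Fin n) → Γ := fun x =>
    x.elim ((2 * m - 1) • g) fun y => y.1.val • g + a (y.2 + y.1)
  have hfv : ∀ j < m, ∀ i, f (webVertex m n j i) = j • g + a (i + j) := by
    intro j hj i
    have hper : Function.Periodic (fun k => a (k + j)) n := fun k => by
      simp only [add_right_comm k n j, hap]
    have := hper.map_mod_nat i
    simp [f, webVertex, Fin.ofNat, Nat.mod_eq_of_lt hj, this]
  -- The `H`-part of a label. With `j = t / 2`, a cycle edge joins positions `i` and `i + 1` under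
  -- the same shift `j`, while a rung keeps `i` and raises the shift by one; both give the same
  -- consecutive sum.
  let d : ℕ → ℕ → H := fun t i =>
    if t + 1 = 2 * m then a i else a (i + t / 2) + a (i + t / 2 + 1)
  have hlabel : ∀ t < 2 * m, ∀ i, edgeLabel f (webEdge m n t i) = t • g + d t i := by
    intro t ht i
    simp only [webEdge, d]
    split_ifs with h1 h2
    · change (2 * m - 1) • g + f (webVertex m n 0 i) = _
      rw [hfv 0 (by omega), zero_nsmul, zero_add, add_zero, show t = 2 * m - 1 by omega]
    · change f _ + f _ = _
      rw [hfv _ (by omega), hfv _ (by omega), add_add_add_comm, ← add_nsmul,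
        show i + 1 + t / 2 = i + t / 2 + 1 by ring]
      rw [Nat.even_iff] at h2
      rw [show t / 2 + t / 2 = t by omega]
      push_cast
      rfl
    · change f _ + f _ = _
      rw [Nat.even_iff] at h2
      rw [hfv _ (by omega), hfv _ (by omega), add_add_add_comm, ← add_nsmul,
        show t / 2 + (t / 2 + 1) = t by omega, ← add_assoc i]
      push_cast
      rfl
  have hlab_inj : ∀ t < 2 * m, ∀ i < n, ∀ t' < 2 * m, ∀ i' < n,
      t • g + (d t i : Γ) = t' • g + d t' i' → t = t' ∧ i = i' := by
    intro t ht i hi t' ht' i' hi' h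
    obtain ⟨rfl, h2⟩ := hcoset t ht t' ht' _ _ h
    refine ⟨rfl, ?_⟩
    simp only [d] at h2
    split_ifs at h2
    · exact ha i hi i' hi' h2
    · exact hsinj _ i hi i' hi' h2
  -- Surjectivity follows by counting: there are `2 * m * n` pairs, as many as elements of `Γ`.
  have hbij : Function.Bijective
      (fun x : Fin (2 * m) × Fin n => x.1.val • g + (d x.1 x.2 : Γ)) := by
    refine Function.Injective.bijective_of_nat_card_le ?_ (by simp [hΓ])
    rintro ⟨t, i⟩ ⟨t', i'⟩ h
    obtain ⟨h1, h2⟩ := hlab_inj t t.2 i i.2 t' t'.2 i' i'.2 h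
    exact Prod.ext (Fin.ext h1) (Fin.ext h2)
  refine ⟨f, ?_, fun _ _ => Set.mem_univ _, ?_, ?_⟩
  · have hnone : ∀ y : Fin m × Fin n, f none ≠ f (some y) := by
      intro y h
      have hy := y.1.2
      have := (hcoset (2 * m - 1) (by omega) y.1 (by omega) 0 (a (y.2 + y.1))
        (by rw [ZeroMemClass.coe_zero, add_zero]; exact h)).1
      omega
    rintro (_ | x) (_ | y) h
    · rfl
    · exact (hnone y h).elim
    · exact (hnone x h.symm).elim
    · have hx := x.1.2
      have hy := y.1.2
      obtain ⟨h1, h2⟩ := hcoset x.1 (by omega) y.1 (by omega) _ _ h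
      rw [h1] at h2
      exact congrArg some (Prod.ext (Fin.ext h1) (Fin.ext (hinj _ _ x.2.2 _ y.2.2 h2)))
  · intro e he e' he' h
    obtain ⟨t, ht, i, hi, rfl⟩ := exists_eq_webEdge he
    obtain ⟨t', ht', i', hi', rfl⟩ := exists_eq_webEdge he'
    rw [hlabel t ht, hlabel t' ht'] at h
    obtain ⟨rfl, rfl⟩ := hlab_inj t ht i hi t' ht' i' hi' h
    rfl
  · intro γ _
    obtain ⟨⟨t, i⟩, rfl⟩ := hbij.2 γ
    exact ⟨webEdge m n t i, webEdge_mem_edgeSet (by omega) t.2 i.2, hlabel t t.2 i⟩
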